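/- Let $K$ be a field, $S=K[x,y]$, and let $I\subset S$ be a monomial ideal such that $R=S/I$ is Cohen–Macaulay. Let $\omega_R=\operatorname{Ext}_S^{h}(R,S)$, $h=\operatorname{height} I$, be its canonical module, and let $\operatorname{tr}(\omega_R)=\sum_{\varphi\in\operatorname{Hom}_R(\omega_R,R)}\varphi(\omega_R)$ be its canonical trace. The ring $R$ is called nearly Gorenstein if $\operatorname{tr}(\omega_R)$ contains the graded maximal ideal $(x,y)R$. Let $\mu(I)$ denote the minimal number of generators of $I$. Then $R$ is nearly Gorenstein if and only if either $\mu(I)\le 2$, or $\mu(I)=3$ and $I=(x^{a},x^{b}y^{c},y^{d})$ for some integers $a>b\ge 0$ and $0\le c<d$ satisfying the conditions: (i) $a-b=1$ or $b=1$; (ii) $d-c=1$ or $c=1$; and (iii) $b+c\ge 1$. -/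

import Mathlib

open MvPolynomial

universe u

/-- A monomial ideal of `K[x₁, …, xₙ]`: an ideal generated by a set of monomials. -/
def IsMonomialIdeal {K : Type u} [Field K] {n : ℕ} (I : Ideal (MvPolynomial (Fin n) K)) : Prop :=
  ∃ E : Set (Fin n →₀ ℕ), I = Ideal.span ((fun e => monomial e (1 : K)) '' E)

/-- A (Noetherian) local ring is Cohen–Macaulay if its depth is its Krull dimension, that is, if
its maximal ideal contains a regular sequence of length the Krull dimension. (The length of a
regular sequence in the maximal ideal never exceeds the dimension.) -/
def IsCohenMacaulayLocal (A : Type u) [CommRing A] [IsLocalRing A] : Prop :=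
  ∃ rs : List A, (∀ r ∈ rs, r ∈ IsLocalRing.maximalIdeal A) ∧
    RingTheory.Sequence.IsRegular A rs ∧ ((rs.length : ℕ∞) : WithBot ℕ∞) = ringKrullDim A

/-- A Noetherian ring is Cohen–Macaulay if all its localizations at maximal ideals are. -/
def IsCohenMacaulay (R : Type u) [CommRing R] : Prop :=
  IsNoetherianRing R ∧ ∀ (m : Ideal R) [m.IsMaximal],
    IsCohenMacaulayLocal (Localization.AtPrime m)

/-- The trace of an `R`-module `M`: the ideal `∑ φ(M)`, the sum over all `φ ∈ Hom_R(M, R)`. -/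
def moduleTrace (R : Type u) [CommRing R] (M : Type u) [AddCommGroup M] [Module R M] : Ideal R :=
  ⨆ φ : M →ₗ[R] R, LinearMap.range φ

/-- The canonical module of `R = S/I`, where `S = K[x₁, …, xₙ]` and `S/I` is Cohen–Macaulay, up to
a shift of the grading, which does not matter here:
`ω_R = Ext^h_S(S/I, S)` with `h = height I`. -/
noncomputable def CanonicalModule {K : Type u} [Field K] {n : ℕ}
    (I : Ideal (MvPolynomial (Fin n) K)) : Type u :=
  CategoryTheory.Abelian.Ext.{u}
    (ModuleCat.of (MvPolynomial (Fin n) K) (MvPolynomial (Fin n) K ⧸ I))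
    (ModuleCat.of (MvPolynomial (Fin n) K) (MvPolynomial (Fin n) K)) I.height.toNat

section CanonicalModule

variable {K : Type u} [Field K] {n : ℕ} (I : Ideal (MvPolynomial (Fin n) K))

noncomputable instance : AddCommGroup (CanonicalModule I) :=
  inferInstanceAs (AddCommGroup (CategoryTheory.Abelian.Ext.{u} _ _ _))

noncomputable instance : Module (MvPolynomial (Fin n) K) (CanonicalModule I) :=
  inferInstanceAs (Module (MvPolynomial (Fin n) K) (CategoryTheory.Abelian.Ext.{u} _ _ _))

/-- The ideal `I` annihilates `Ext_S(S/I, S)`. -/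
theorem CanonicalModule.isTorsionBySet :
    Module.IsTorsionBySet (MvPolynomial (Fin n) K) (CanonicalModule I) (I : Set _) := by
  intro w a
  obtain ⟨a, ha⟩ := a
  have h0 : a • CategoryTheory.CategoryStruct.id
      (ModuleCat.of (MvPolynomial (Fin n) K) (MvPolynomial (Fin n) K ⧸ I)) = 0 := by
    refine ModuleCat.hom_ext (LinearMap.ext fun (x : MvPolynomial (Fin n) K ⧸ I) => ?_)
    have : a • x = 0 := by
      obtain ⟨y, rfl⟩ := Ideal.Quotient.mk_surjective x
      exact Ideal.Quotient.eq_zero_iff_mem.mpr (I.mul_mem_right y ha)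
    simpa using this
  have h1 : a • (show CategoryTheory.Abelian.Ext.{u} _ _ _ from w) =
      (CategoryTheory.Abelian.Ext.mk₀ (a • CategoryTheory.CategoryStruct.id
        (ModuleCat.of (MvPolynomial (Fin n) K) (MvPolynomial (Fin n) K ⧸ I)))).comp
        (show CategoryTheory.Abelian.Ext.{u} _ _ _ from w) (zero_add _) := by
    rw [CategoryTheory.Abelian.Ext.mk₀_smul, CategoryTheory.Abelian.Ext.smul_comp,
      CategoryTheory.Abelian.Ext.mk₀_id_comp]
  rw [h0, CategoryTheory.Abelian.Ext.mk₀_zero, CategoryTheory.Abelian.Ext.zero_comp] at h1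
  exact h1

/-- The induced `S/I`-module structure on the canonical module. -/
noncomputable instance : Module (MvPolynomial (Fin n) K ⧸ I) (CanonicalModule I) :=
  (CanonicalModule.isTorsionBySet I).module

instance : IsScalarTower (MvPolynomial (Fin n) K) (MvPolynomial (Fin n) K ⧸ I)
    (CanonicalModule I) :=
  (CanonicalModule.isTorsionBySet I).isScalarTower

end CanonicalModule

/-- The Cohen–Macaulay ring `R = K[x₁, …, xₙ]/I`, `I` graded, is nearly Gorenstein if `tr(ω_R)`
contains the graded maximal ideal `(x₁, …, xₙ)R`. -/
def IsNearlyGorenstein {K : Type u} [Field K] {n : ℕ}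
    (I : Ideal (MvPolynomial (Fin n) K)) : Prop :=
  Ideal.map (Ideal.Quotient.mk I) (Ideal.span (Set.range X)) ≤
    moduleTrace (MvPolynomial (Fin n) K ⧸ I) (CanonicalModule I)

/-!
Write `S = K[x, y]`. If `f, g` is a regular sequence contained in an ideal `I` of height two and
`J = (f, g)`, then shifting degrees twice along multiplication by `f` on `S` and by `g` on `S/(f)`
gives `ω_R = Ext²(S/I, S) ≅ Hom(S/I, S/J)`, and the right side is `(J : I)/J`
(`nonempty_ext_two_equiv`). All facts about the trace follow from this description.

* *Lower bound.* The projection `S/J → S/I` shows that `tr(ω_R)` contains the image of `J : I`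
  (`mk_mem_trace_of_forall_mul_mem`). For `I = (x ^ a, y ^ d)` take `J = I`; for
  `I = (x ^ a, x ^ b y ^ c, y ^ d)` the two choices `(x ^ a, y ^ d)` and
  `(x ^ b y ^ c, x ^ a + y ^ d)` of `J` put `x ^ (a - b)`, `y ^ (d - c)`, `x ^ b` and `y ^ c` into the
  trace (`isNearlyGorenstein_span_triple`).
* *Upper bound.* Let `a` and `d` be the least exponents with `x ^ a, y ^ d ∈ I`, and
  `J = (x ^ a, y ^ d)`. Unless `I = (x ^ a, x ^ b y ^ c, y ^ d)` with `a - b = 1` or `b = 1`, looking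
  at the staircase of `I` shows `x ^ (a - 2) ω_R ⊆ y ω_R`. Then `ω_R / y ω_R` maps to
  `R / y R = K[x]/(x ^ a)` with image killed by `x ^ (a - 2)`, so the trace lies in `(x ^ 2, y) R` and
  does not contain `x` (`exists_corner_of_X_mem_trace`). The same holds with the variables exchanged,
  and the two descriptions of `I` must agree (`exists_span_triple_of_X_mem_trace`).

A monomial ideal with Cohen-Macaulay quotient is principal, with `ω_R ≅ R`, or contains powers of both
variables (`IsMonomialIdeal.isPrincipal_or_exists_pow_mem`). Minimal monomial generators are
independent modulo `(x, y) I`, so an ideal of the second kind with at most two generators is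
`(x ^ a, y ^ d)` (`IsMonomialIdeal.eq_span_pair_of_spanFinrank_le_two`).
-/

/-! ### Ext and regular sequences -/

open CategoryTheory in
theorem subsingleton_ext_zero_of_smul_eq_zero {A M N : Type u} [CommRing A] [AddCommGroup M]
    [Module A M] [AddCommGroup N] [Module A N] (r : A) (hN : ∀ n : N, r • n = 0 → n = 0)
    (hM : ∀ m : M, r • m = 0) :
    Subsingleton (Abelian.Ext.{u} (ModuleCat.of A M) (ModuleCat.of A N) 0) := by
  refine ((Abelian.Ext.linearEquiv₀ (R := A)).trans
    ModuleCat.homLinearEquiv).toEquiv.subsingleton_congr.mpr ⟨fun φ ψ => ?_⟩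
  ext m
  have h (χ : M →ₗ[A] N) : χ m = 0 := hN _ (by rw [← map_smul, hM, map_zero])
  exact (h φ).trans (h ψ).symm

open CategoryTheory in
/-- If `r` annihilates `M` and `0 → N → N → Q → 0` is exact, the first map being multiplication by
`r`, then the connecting map `Extᵏ(M, Q) → Extᵏ⁺¹(M, N)` is bijective as soon as `Extᵏ(M, N) = 0`:
multiplication by `r` is zero on `Extᵏ⁺¹(M, N)`. -/
theorem nonempty_ext_equiv_ext_succ {A M N Q : Type u} [CommRing A] [AddCommGroup M] [Module A M]
    [AddCommGroup N] [Module A N] [AddCommGroup Q] [Module A Q] (r : A)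
    (hN : ∀ n : N, r • n = 0 → n = 0) (hM : ∀ m : M, r • m = 0)
    (q : N →ₗ[A] Q) (hq : Function.Surjective q)
    (hex : Function.Exact (LinearMap.lsmul A N r) q) (k : ℕ)
    (hk : Subsingleton (Abelian.Ext.{u} (ModuleCat.of A M) (ModuleCat.of A N) k)) :
    Nonempty (Abelian.Ext.{u} (ModuleCat.of A M) (ModuleCat.of A Q) k ≃ₗ[A]
      Abelian.Ext.{u} (ModuleCat.of A M) (ModuleCat.of A N) (k + 1)) := by
  let T := ModuleCat.shortComplexOfCompEqZero (LinearMap.lsmul A N r) q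
    hex.linearMap_comp_eq_zero
  have hT : T.ShortExact :=
    { exact := ModuleCat.shortComplex_exact _ hex
      mono_f := (ModuleCat.mono_iff_injective _).mpr
        ((injective_iff_map_eq_zero (LinearMap.lsmul A N r)).mpr fun n hn => hN n hn)
      epi_g := (ModuleCat.epi_iff_surjective _).mpr hq }
  have hf : T.f = r • 𝟙 (ModuleCat.of A N) := rfl
  have hM' : r • 𝟙 (ModuleCat.of A M) = 0 :=
    ModuleCat.hom_ext (LinearMap.ext fun m => hM m)
  refine ⟨LinearEquiv.ofBijective
    (Abelian.Ext.postcompOfLinear hT.extClass A (ModuleCat.of A M) rfl) ⟨?_, fun x => ?_⟩⟩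
  · refine (injective_iff_map_eq_zero _).mpr fun x hx => ?_
    obtain ⟨y, rfl⟩ := Abelian.Ext.covariant_sequence_exact₃ _ hT x rfl hx
    have : y = 0 := Subsingleton.elim (α := Abelian.Ext.{u} (ModuleCat.of A M)
      (ModuleCat.of A N) k) _ _
    rw [this, Abelian.Ext.zero_comp]
  · refine Abelian.Ext.covariant_sequence_exact₁ _ hT x ?_ rfl
    rw [hf, Abelian.Ext.mk₀_smul, Abelian.Ext.comp_smul, Abelian.Ext.comp_mk₀_id]
    have h := Abelian.Ext.mk₀_id_comp x
    have h2 : r • x = 0 := by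
      rw [← h, ← Abelian.Ext.smul_comp, ← Abelian.Ext.mk₀_smul, hM', Abelian.Ext.mk₀_zero,
        Abelian.Ext.zero_comp]
    exact h2

theorem nonempty_ext_one_equiv {A : Type u} [CommRing A] [IsDomain A] {I : Ideal A} {f : A}
    (hf : f ≠ 0) (hfI : f ∈ I) :
    Nonempty (CategoryTheory.Abelian.Ext.{u} (ModuleCat.of A (A ⧸ I)) (ModuleCat.of A A) 1 ≃ₗ[A]
      (A ⧸ I →ₗ[A] A ⧸ Ideal.span {f})) := by
  have hM (m : A ⧸ I) : f • m = 0 := by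
    obtain ⟨y, rfl⟩ := Ideal.Quotient.mk_surjective m
    exact Ideal.Quotient.eq_zero_iff_mem.mpr (I.mul_mem_right y hfI)
  have hN (n : A) (h : f • n = 0) : n = 0 := (mul_eq_zero.mp h).resolve_left hf
  obtain ⟨e⟩ := nonempty_ext_equiv_ext_succ f hN hM (Ideal.span {f}).mkQ
    (Submodule.mkQ_surjective _) (fun n => by
      rw [Submodule.mkQ_apply, Submodule.Quotient.mk_eq_zero, Ideal.mem_span_singleton]
      exact ⟨fun ⟨c, h⟩ => ⟨c, h.symm⟩, fun ⟨c, h⟩ => ⟨c, h.symm⟩⟩) 0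
    (subsingleton_ext_zero_of_smul_eq_zero f hN hM)
  exact ⟨e.symm.trans ((CategoryTheory.Abelian.Ext.linearEquiv₀ (R := A)).trans
    ModuleCat.homLinearEquiv)⟩

/-- The hypothesis `hfg` says that `g` is regular modulo `f`, so that `f, g` is a regular sequence. -/
theorem nonempty_ext_two_equiv {A : Type u} [CommRing A] [IsDomain A] {I : Ideal A} {f g : A}
    (hf : f ≠ 0) (hfI : f ∈ I) (hgI : g ∈ I) (hfg : ∀ h, f ∣ g * h → f ∣ h) :
    Nonempty (CategoryTheory.Abelian.Ext.{u} (ModuleCat.of A (A ⧸ I)) (ModuleCat.of A A) 2 ≃ₗ[A]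
      (A ⧸ I →ₗ[A] A ⧸ Ideal.span {f, g})) := by
  have hM {r : A} (hr : r ∈ I) (m : A ⧸ I) : r • m = 0 := by
    obtain ⟨y, rfl⟩ := Ideal.Quotient.mk_surjective m
    exact Ideal.Quotient.eq_zero_iff_mem.mpr (I.mul_mem_right y hr)
  have hN (n : A) (h : f • n = 0) : n = 0 := (mul_eq_zero.mp h).resolve_left hf
  have hN' (n : A ⧸ Ideal.span {f}) (h : g • n = 0) : n = 0 := by
    obtain ⟨y, rfl⟩ := Ideal.Quotient.mk_surjective n
    rw [Ideal.Quotient.eq_zero_iff_mem, Ideal.mem_span_singleton]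
    exact hfg y (Ideal.mem_span_singleton.mp (Ideal.Quotient.eq_zero_iff_mem.mp h))
  obtain ⟨e₀⟩ := nonempty_ext_one_equiv hf hfI
  have hs := subsingleton_ext_zero_of_smul_eq_zero g hN' (hM hgI)
  have hs1 : Subsingleton (CategoryTheory.Abelian.Ext.{u} (ModuleCat.of A (A ⧸ I))
      (ModuleCat.of A A) 1) :=
    (e₀.trans ((CategoryTheory.Abelian.Ext.linearEquiv₀ (R := A)).trans
      ModuleCat.homLinearEquiv).symm).toEquiv.subsingleton_congr.mpr hs
  obtain ⟨e₁⟩ := nonempty_ext_equiv_ext_succ f hN (hM hfI) (Ideal.span {f}).mkQ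
    (Submodule.mkQ_surjective _) (fun n => by
      rw [Submodule.mkQ_apply, Submodule.Quotient.mk_eq_zero, Ideal.mem_span_singleton]
      exact ⟨fun ⟨c, h⟩ => ⟨c, h.symm⟩, fun ⟨c, h⟩ => ⟨c, h.symm⟩⟩) 1 hs1
  have hle : Ideal.span {f} ≤ Ideal.span {f, g} := Ideal.span_mono (by simp)
  obtain ⟨e₂⟩ := nonempty_ext_equiv_ext_succ g hN' (hM hgI) (Submodule.factor hle)
    (Submodule.factor_surjective hle) (fun n => by
      obtain ⟨y, rfl⟩ := Ideal.Quotient.mk_surjective n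
      have h1 : Submodule.factor hle (Ideal.Quotient.mk (Ideal.span {f}) y) = 0 ↔
          y ∈ Ideal.span {f, g} := Submodule.Quotient.mk_eq_zero _
      rw [h1, Ideal.mem_span_pair]
      constructor
      · rintro ⟨a, b, rfl⟩
        refine ⟨Ideal.Quotient.mk _ b, ?_⟩
        refine Ideal.Quotient.eq.mpr (Ideal.mem_span_singleton.mpr ⟨-a, ?_⟩)
        simp only [smul_eq_mul]
        ring
      · rintro ⟨c, h⟩
        obtain ⟨b, rfl⟩ := Ideal.Quotient.mk_surjective c
        obtain ⟨a, ha⟩ := Ideal.mem_span_singleton.mp (Ideal.Quotient.eq.mp h)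
        simp only [smul_eq_mul] at ha
        exact ⟨-a, b, by linear_combination ha⟩) 0 hs
  exact ⟨(e₂.trans e₁).symm.trans ((CategoryTheory.Abelian.Ext.linearEquiv₀ (R := A)).trans
    ModuleCat.homLinearEquiv)⟩

/-! ### The canonical module and its trace -/

theorem nonempty_canonicalModule_equiv_ext {K : Type u} [Field K] {n : ℕ}
    {I : Ideal (MvPolynomial (Fin n) K)} {k : ℕ} (hk : I.height.toNat = k) :
    Nonempty (CanonicalModule I ≃ₗ[MvPolynomial (Fin n) K] CategoryTheory.Abelian.Ext.{u}
      (ModuleCat.of (MvPolynomial (Fin n) K) (MvPolynomial (Fin n) K ⧸ I))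
      (ModuleCat.of (MvPolynomial (Fin n) K) (MvPolynomial (Fin n) K)) k) := by
  subst hk
  exact ⟨LinearEquiv.refl _ _⟩

theorem nonempty_canonicalModule_equiv_of_height_eq_two {K : Type u} [Field K] {n : ℕ}
    {I : Ideal (MvPolynomial (Fin n) K)} (hI : I.height = 2) {f g : MvPolynomial (Fin n) K}
    (hf : f ≠ 0) (hfI : f ∈ I) (hgI : g ∈ I) (hfg : ∀ h, f ∣ g * h → f ∣ h) :
    Nonempty (CanonicalModule I ≃ₗ[MvPolynomial (Fin n) K]
      (MvPolynomial (Fin n) K ⧸ I →ₗ[MvPolynomial (Fin n) K]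
        MvPolynomial (Fin n) K ⧸ Ideal.span {f, g})) := by
  obtain ⟨e⟩ := nonempty_canonicalModule_equiv_ext (I := I) (k := 2) (by rw [hI]; rfl)
  obtain ⟨e'⟩ := nonempty_ext_two_equiv hf hfI hgI hfg
  exact ⟨e.trans e'⟩

/-- This covers `f = 0`, where the canonical module is `Hom(S, S)`. -/
theorem nonempty_canonicalModule_span_singleton_equiv {K : Type u} [Field K] {n : ℕ}
    {f : MvPolynomial (Fin n) K} (hf : ¬ IsUnit f) :
    Nonempty (CanonicalModule (Ideal.span {f}) ≃ₗ[MvPolynomial (Fin n) K]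
      (MvPolynomial (Fin n) K ⧸ Ideal.span {f} →ₗ[MvPolynomial (Fin n) K]
        MvPolynomial (Fin n) K ⧸ Ideal.span {f})) := by
  by_cases h0 : f = 0
  · subst h0
    have hb : Ideal.span {(0 : MvPolynomial (Fin n) K)} = ⊥ := Ideal.span_singleton_zero
    obtain ⟨e⟩ := nonempty_canonicalModule_equiv_ext
      (I := Ideal.span {(0 : MvPolynomial (Fin n) K)}) (k := 0)
      (by rw [hb, Ideal.height_bot]; rfl)
    exact ⟨(e.trans
      ((CategoryTheory.Abelian.Ext.linearEquiv₀ (R := MvPolynomial (Fin n) K)).trans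
        ModuleCat.homLinearEquiv)).trans
      (LinearEquiv.congrRight (Submodule.quotEquivOfEqBot _ hb).symm)⟩
  · obtain ⟨e⟩ := nonempty_canonicalModule_equiv_ext (I := Ideal.span {f}) (k := 1)
      (by rw [Ideal.height_span_singleton_eq_one_of_mem_nonZeroDivisors
        (mem_nonZeroDivisors_of_ne_zero h0) hf]; rfl)
    obtain ⟨e'⟩ := nonempty_ext_one_equiv h0 (Ideal.mem_span_singleton_self f)
    exact ⟨e.trans e'⟩

theorem not_X_dvd_X_pow {K : Type u} [Field K] {i j : Fin 2} (hij : i ≠ j) (d : ℕ) :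
    ¬ (X i : MvPolynomial (Fin 2) K) ∣ X j ^ d := fun h =>
  hij ((X_dvd_X (R := K)).mp ((X_prime (R := K) (i := i)).dvd_of_dvd_pow h))

theorem nonempty_canonicalModule_equiv_of_pow_mem {K : Type u} [Field K]
    {I : Ideal (MvPolynomial (Fin 2) K)} (hht : I.height = 2) {i j : Fin 2} (hij : i ≠ j) {a d : ℕ}
    (ha : X i ^ a ∈ I) (hd : X j ^ d ∈ I) :
    Nonempty (CanonicalModule I ≃ₗ[MvPolynomial (Fin 2) K]
      (MvPolynomial (Fin 2) K ⧸ I →ₗ[MvPolynomial (Fin 2) K]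
        MvPolynomial (Fin 2) K ⧸
          (Ideal.span {X i ^ a, X j ^ d} : Ideal (MvPolynomial (Fin 2) K)))) :=
  nonempty_canonicalModule_equiv_of_height_eq_two hht (pow_ne_zero a (X_ne_zero (R := K) i)) ha hd
    (fun _ => (X_prime (R := K) (i := i)).pow_dvd_of_dvd_mul_left a (not_X_dvd_X_pow hij d))

/-- If `ω_R ≅ Hom(S/I, S/J)` with `J ⊆ I`, then `tr(ω_R)` contains the image of `J : I`: evaluate
`ω_R → S/J → S/I` at multiplication by an element of `J : I`. -/
theorem mk_mem_trace_of_forall_mul_mem {K : Type u} [Field K] {n : ℕ}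
    {I J : Ideal (MvPolynomial (Fin n) K)} (hJI : J ≤ I)
    (e : CanonicalModule I ≃ₗ[MvPolynomial (Fin n) K]
      (MvPolynomial (Fin n) K ⧸ I →ₗ[MvPolynomial (Fin n) K] MvPolynomial (Fin n) K ⧸ J))
    {p : MvPolynomial (Fin n) K} (hp : ∀ m ∈ I, p * m ∈ J) :
    Ideal.Quotient.mk I p ∈ moduleTrace (MvPolynomial (Fin n) K ⧸ I) (CanonicalModule I) := by
  let ev : (MvPolynomial (Fin n) K ⧸ I →ₗ[MvPolynomial (Fin n) K] MvPolynomial (Fin n) K ⧸ J)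
      →ₗ[MvPolynomial (Fin n) K] MvPolynomial (Fin n) K ⧸ I :=
    (Submodule.factor hJI).comp (LinearMap.applyₗ (Ideal.Quotient.mk I 1))
  let φ : CanonicalModule I →ₗ[MvPolynomial (Fin n) K ⧸ I] MvPolynomial (Fin n) K ⧸ I :=
    (ev.comp e.toLinearMap).extendScalarsOfSurjective Ideal.Quotient.mk_surjective
  let w : MvPolynomial (Fin n) K ⧸ I →ₗ[MvPolynomial (Fin n) K] MvPolynomial (Fin n) K ⧸ J :=
    Submodule.liftQ I (J.mkQ.comp (LinearMap.lsmul (MvPolynomial (Fin n) K) _ p))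
      fun m hm => (Submodule.Quotient.mk_eq_zero J).mpr (hp m hm)
  refine Submodule.mem_iSup_of_mem φ ⟨e.symm w, ?_⟩
  change ev (e (e.symm w)) = _
  rw [e.apply_symm_apply]
  change Submodule.factor hJI (w (Submodule.Quotient.mk 1)) = _
  have : w (Submodule.Quotient.mk 1) = Submodule.Quotient.mk (p * 1) := rfl
  rw [this, mul_one]
  rfl

/-- An upper bound for the trace when `ω_R ≅ Hom(S/I, S/J)`. If `s (J : I) ⊆ t (J : I) + J`, that is,
`s ω_R ⊆ t ω_R`, then every `φ : ω_R → R` satisfies `s φ(ω_R) ⊆ t R`. -/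
theorem trace_le_of_forall_mul_sub_mem {K : Type u} [Field K] {n : ℕ}
    {I J : Ideal (MvPolynomial (Fin n) K)}
    (e : CanonicalModule I ≃ₗ[MvPolynomial (Fin n) K]
      (MvPolynomial (Fin n) K ⧸ I →ₗ[MvPolynomial (Fin n) K] MvPolynomial (Fin n) K ⧸ J))
    {s t : MvPolynomial (Fin n) K} {T : Ideal (MvPolynomial (Fin n) K ⧸ I)}
    (h : ∀ p, (∀ m ∈ I, p * m ∈ J) → ∃ p', (∀ m ∈ I, p' * m ∈ J) ∧ s * p - t * p' ∈ J)
    (hT : ∀ r, s * r ∈ Ideal.span {t} ⊔ I → Ideal.Quotient.mk I r ∈ T) :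
    moduleTrace (MvPolynomial (Fin n) K ⧸ I) (CanonicalModule I) ≤ T := by
  refine iSup_le fun φ => ?_
  rintro _ ⟨z, rfl⟩
  obtain ⟨w, rfl⟩ := e.symm.surjective z
  obtain ⟨p, hp⟩ := Ideal.Quotient.mk_surjective (w (Submodule.Quotient.mk 1))
  have hw (m : MvPolynomial (Fin n) K) :
      w (Submodule.Quotient.mk m) = Ideal.Quotient.mk J (p * m) := by
    have : (Submodule.Quotient.mk m : MvPolynomial (Fin n) K ⧸ I) =
        m • Submodule.Quotient.mk 1 := by
      rw [← Submodule.Quotient.mk_smul, smul_eq_mul, mul_one]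
    rw [this, map_smul, ← hp, mul_comm, map_mul]
    rfl
  have hpI (m) (hm : m ∈ I) : p * m ∈ J := by
    rw [← Ideal.Quotient.eq_zero_iff_mem, ← hw, (Submodule.Quotient.mk_eq_zero I).mpr hm, map_zero]
  obtain ⟨p', hp', hpp⟩ := h p hpI
  let w' : MvPolynomial (Fin n) K ⧸ I →ₗ[MvPolynomial (Fin n) K] MvPolynomial (Fin n) K ⧸ J :=
    Submodule.liftQ I (J.mkQ.comp (LinearMap.lsmul (MvPolynomial (Fin n) K) _ p'))
      fun m hm => (Submodule.Quotient.mk_eq_zero J).mpr (hp' m hm)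
  have hww : s • w = t • w' := by
    refine LinearMap.ext fun m => ?_
    obtain ⟨m, rfl⟩ := Ideal.Quotient.mk_surjective m
    change s • w (Submodule.Quotient.mk m) = Ideal.Quotient.mk J (t * (p' * m))
    rw [hw]
    change Ideal.Quotient.mk J (s * (p * m)) = _
    rw [Ideal.Quotient.eq]
    have : s * (p * m) - t * (p' * m) = (s * p - t * p') * m := by ring
    rw [this]
    exact J.mul_mem_right m hpp
  obtain ⟨r, hr⟩ := Ideal.Quotient.mk_surjective (φ (e.symm w))
  obtain ⟨r', hr'⟩ := Ideal.Quotient.mk_surjective (φ (e.symm w'))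
  have key : s • φ (e.symm w) = t • φ (e.symm w') := by
    have h1 := (φ.restrictScalars (MvPolynomial (Fin n) K)).map_smul s (e.symm w)
    have h2 := (φ.restrictScalars (MvPolynomial (Fin n) K)).map_smul t (e.symm w')
    rw [← map_smul, hww, map_smul] at h1
    exact h1.symm.trans h2
  rw [← hr]
  refine hT r ?_
  rw [← hr, ← hr'] at key
  have key' : s * r - t * r' ∈ I := Ideal.Quotient.eq.mp key
  have : s * r = t * r' + (s * r - t * r') := by ring
  rw [this]
  exact Submodule.add_mem_sup (Ideal.mul_mem_right _ _ (Ideal.mem_span_singleton_self t)) key'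

/-! ### Monomial ideals in two variables -/

theorem IsMonomialIdeal.mem_iff {K : Type u} [Field K] {n : ℕ}
    {I : Ideal (MvPolynomial (Fin n) K)} (hI : IsMonomialIdeal I) {p : MvPolynomial (Fin n) K} :
    p ∈ I ↔ ∀ e ∈ p.support, monomial e (1 : K) ∈ I := by
  obtain ⟨E, rfl⟩ := hI
  rw [mem_ideal_span_monomial_image]
  classical
  refine forall₂_congr fun e _ => ?_
  rw [mem_ideal_span_monomial_image, support_monomial, if_neg one_ne_zero]
  simp

theorem monomial_eq_X_pow_mul_X_pow {K : Type u} [Field K] {i j : Fin 2} (hij : i ≠ j)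
    (e : Fin 2 →₀ ℕ) : monomial e (1 : K) = X i ^ e i * X j ^ e j := by
  rw [monomial_eq, map_one, one_mul, Finsupp.prod_fintype _ _ (fun _ => pow_zero _),
    Fin.prod_univ_two]
  obtain ⟨rfl, rfl⟩ | ⟨rfl, rfl⟩ : (i = 0 ∧ j = 1) ∨ (i = 1 ∧ j = 0) := by lia
  · rfl
  · exact mul_comm _ _

theorem X_pow_mul_X_pow_eq_monomial {K : Type u} [Field K] {i j : Fin 2} (s t : ℕ) :
    (X i ^ s * X j ^ t : MvPolynomial (Fin 2) K) =
      monomial (Finsupp.single i s + Finsupp.single j t) 1 := by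
  rw [X_pow_eq_monomial, X_pow_eq_monomial, monomial_mul, one_mul]

theorem mem_span_X_pow_mul_X_pow_iff {K : Type u} [Field K] {i j : Fin 2} (hij : i ≠ j)
    (P : Set (ℕ × ℕ)) (p : MvPolynomial (Fin 2) K) :
    p ∈ Ideal.span ((fun q : ℕ × ℕ => X i ^ q.1 * X j ^ q.2) '' P) ↔
      ∀ e ∈ p.support, ∃ q ∈ P, q.1 ≤ e i ∧ q.2 ≤ e j := by
  have h : (fun q : ℕ × ℕ => (X i ^ q.1 * X j ^ q.2 : MvPolynomial (Fin 2) K)) '' P =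
      (fun e => monomial e (1 : K)) ''
        ((fun q : ℕ × ℕ => Finsupp.single i q.1 + Finsupp.single j q.2) '' P) := by
    rw [Set.image_image]
    exact Set.image_congr fun q _ => X_pow_mul_X_pow_eq_monomial _ _
  rw [h, mem_ideal_span_monomial_image]
  refine forall₂_congr fun e _ => ?_
  rw [Set.exists_mem_image]
  refine exists_congr fun q => and_congr_right fun _ => ?_
  rw [Finsupp.le_def]
  obtain ⟨rfl, rfl⟩ | ⟨rfl, rfl⟩ : (i = 0 ∧ j = 1) ∨ (i = 1 ∧ j = 0) := by lia
  · simp [Fin.forall_fin_two]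
  · simp [Fin.forall_fin_two, and_comm]

theorem isMonomialIdeal_span_X_pow_mul_X_pow {K : Type u} [Field K] (i j : Fin 2)
    (P : Set (ℕ × ℕ)) : IsMonomialIdeal (Ideal.span
      ((fun q : ℕ × ℕ => (X i ^ q.1 * X j ^ q.2 : MvPolynomial (Fin 2) K)) '' P)) := by
  refine ⟨(fun q : ℕ × ℕ => Finsupp.single i q.1 + Finsupp.single j q.2) '' P, ?_⟩
  rw [Set.image_image]
  exact congrArg _ (Set.image_congr fun q _ => X_pow_mul_X_pow_eq_monomial _ _)

theorem X_pow_mul_X_pow_mem_span_iff {K : Type u} [Field K] {i j : Fin 2} (hij : i ≠ j)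
    (P : Set (ℕ × ℕ)) (s t : ℕ) :
    (X i ^ s * X j ^ t : MvPolynomial (Fin 2) K) ∈
      Ideal.span ((fun q : ℕ × ℕ => X i ^ q.1 * X j ^ q.2) '' P) ↔
      ∃ q ∈ P, q.1 ≤ s ∧ q.2 ≤ t := by
  classical
  rw [mem_span_X_pow_mul_X_pow_iff hij, X_pow_mul_X_pow_eq_monomial, support_monomial,
    if_neg one_ne_zero]
  simp [hij, hij.symm]

theorem span_pair_eq_span_image {K : Type u} [Field K] (i j : Fin 2) (a d : ℕ) :
    Ideal.span {X i ^ a, (X j ^ d : MvPolynomial (Fin 2) K)} =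
      Ideal.span ((fun q : ℕ × ℕ => X i ^ q.1 * X j ^ q.2) '' {(a, 0), (0, d)}) := by
  simp [Set.image_pair]

theorem span_triple_eq_span_image {K : Type u} [Field K] (i j : Fin 2) (a b c d : ℕ) :
    Ideal.span {X i ^ a, X i ^ b * X j ^ c, (X j ^ d : MvPolynomial (Fin 2) K)} =
      Ideal.span ((fun q : ℕ × ℕ => X i ^ q.1 * X j ^ q.2) '' {(a, 0), (b, c), (0, d)}) := by
  simp [Set.image_insert_eq]

theorem mem_span_pair_iff {K : Type u} [Field K] {i j : Fin 2} (hij : i ≠ j) (a d : ℕ)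
    (p : MvPolynomial (Fin 2) K) :
    p ∈ Ideal.span {X i ^ a, X j ^ d} ↔ ∀ e ∈ p.support, a ≤ e i ∨ d ≤ e j := by
  rw [span_pair_eq_span_image, mem_span_X_pow_mul_X_pow_iff hij]
  simp

theorem X_pow_mul_X_pow_mem_span_pair_iff {K : Type u} [Field K] {i j : Fin 2} (hij : i ≠ j)
    (a d s t : ℕ) : (X i ^ s * X j ^ t : MvPolynomial (Fin 2) K) ∈
      Ideal.span {X i ^ a, X j ^ d} ↔ a ≤ s ∨ d ≤ t := by
  rw [span_pair_eq_span_image, X_pow_mul_X_pow_mem_span_iff hij]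
  simp

theorem X_pow_mul_X_pow_mem_span_triple_iff {K : Type u} [Field K] {i j : Fin 2} (hij : i ≠ j)
    (a b c d s t : ℕ) : (X i ^ s * X j ^ t : MvPolynomial (Fin 2) K) ∈
      Ideal.span {X i ^ a, X i ^ b * X j ^ c, X j ^ d} ↔ a ≤ s ∨ (b ≤ s ∧ c ≤ t) ∨ d ≤ t := by
  rw [span_triple_eq_span_image, X_pow_mul_X_pow_mem_span_iff hij]
  simp

theorem X_pow_mul_X_pow_mem_of_le {K : Type u} [Field K] {I : Ideal (MvPolynomial (Fin 2) K)}
    {i j : Fin 2} {s t s' t' : ℕ} (hs : s ≤ s') (ht : t ≤ t') (h : X i ^ s * X j ^ t ∈ I) :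
    X i ^ s' * X j ^ t' ∈ I :=
  I.mem_of_dvd (mul_dvd_mul (pow_dvd_pow _ hs) (pow_dvd_pow _ ht)) h

theorem IsMonomialIdeal.le_of_forall {K : Type u} [Field K]
    {I J : Ideal (MvPolynomial (Fin 2) K)} (hI : IsMonomialIdeal I)
    {i j : Fin 2} (hij : i ≠ j) (h : ∀ s t, X i ^ s * X j ^ t ∈ I → X i ^ s * X j ^ t ∈ J) :
    I ≤ J := by
  obtain ⟨E, rfl⟩ := hI
  refine Ideal.span_le.mpr ?_
  rintro _ ⟨e, he, rfl⟩
  have := h (e i) (e j)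
  rw [← monomial_eq_X_pow_mul_X_pow hij] at this
  exact this (Ideal.subset_span ⟨e, he, rfl⟩)

theorem IsMonomialIdeal.eq_span_pair {K : Type u} [Field K]
    {I : Ideal (MvPolynomial (Fin 2) K)} (hI : IsMonomialIdeal I) {i j : Fin 2} (hij : i ≠ j)
    {a d : ℕ} (h : ∀ s t, X i ^ s * X j ^ t ∈ I ↔ a ≤ s ∨ d ≤ t) :
    I = Ideal.span {X i ^ a, X j ^ d} := by
  refine le_antisymm (hI.le_of_forall hij fun s t hst => ?_) ?_
  · rwa [X_pow_mul_X_pow_mem_span_pair_iff hij, ← h]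
  · rw [span_pair_eq_span_image]
    refine (isMonomialIdeal_span_X_pow_mul_X_pow i j _).le_of_forall hij fun s t hst => ?_
    rwa [← span_pair_eq_span_image, X_pow_mul_X_pow_mem_span_pair_iff hij, ← h] at hst

theorem IsMonomialIdeal.eq_span_triple {K : Type u} [Field K]
    {I : Ideal (MvPolynomial (Fin 2) K)} (hI : IsMonomialIdeal I) {i j : Fin 2} (hij : i ≠ j)
    {a b c d : ℕ} (h : ∀ s t, X i ^ s * X j ^ t ∈ I ↔ a ≤ s ∨ (b ≤ s ∧ c ≤ t) ∨ d ≤ t) :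
    I = Ideal.span {X i ^ a, X i ^ b * X j ^ c, X j ^ d} := by
  refine le_antisymm (hI.le_of_forall hij fun s t hst => ?_) ?_
  · rwa [X_pow_mul_X_pow_mem_span_triple_iff hij, ← h]
  · rw [span_triple_eq_span_image]
    refine (isMonomialIdeal_span_X_pow_mul_X_pow i j _).le_of_forall hij fun s t hst => ?_
    rwa [← span_triple_eq_span_image, X_pow_mul_X_pow_mem_span_triple_iff hij, ← h] at hst

/-- A statement about a staircase, in which `M s t` says that `x ^ s * y ^ t` is in `I`. Suppose that
`x ^ p * y ^ q`, with `p ≤ 1`, is in `J : I`, where `J = (x ^ a, y ^ d)`, and that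
`x ^ (a - 2 + p) * y ^ q` is not `y` times an element of `J : I`. Then `I` has at most three minimal
generators and the corner exponent `b` satisfies `a - b = 1` or `b = 1`. -/
theorem exists_three_corners {M : ℕ → ℕ → Prop}
    (hM : ∀ s t s' t', s ≤ s' → t ≤ t' → M s t → M s' t') {a d p q : ℕ} (ha : M a 0) (ha2 : 2 ≤ a)
    (hd : M 0 d) (hd' : ∀ t, M 0 t → d ≤ t)
    (hpq : ∀ s t, M s t → a ≤ p + s ∨ d ≤ q + t) (hp : p ≤ 1)
    (h : q = 0 ∨ ∃ s t, M s t ∧ a - 2 + p + s < a ∧ q - 1 + t < d) :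
    ∃ b c, b < a ∧ c ≤ d ∧ (a - b = 1 ∨ b = 1) ∧
      ∀ s t, M s t ↔ a ≤ s ∨ (b ≤ s ∧ c ≤ t) ∨ d ≤ t := by
  rcases Nat.eq_zero_or_pos q with rfl | hq
  -- if `q = 0`, then `I ⊆ (x ^ (a - 1), y ^ d)`; otherwise `p = 0` and `I ⊆ (x ^ a, y ^ t₀)`, where
  -- `x * y ^ t₀ ∈ I`
  · classical
    have hex : ∃ t, M (a - 1) t := ⟨d, hM _ _ _ _ (Nat.zero_le _) le_rfl hd⟩
    have hc := Nat.find_spec hex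
    refine ⟨a - 1, Nat.find hex, by lia, Nat.find_min' hex
      (hM _ _ _ _ (Nat.zero_le _) le_rfl hd), Or.inl (by lia), fun s t => ⟨fun hst => ?_, ?_⟩⟩
    · by_cases h1 : a ≤ s
      · exact Or.inl h1
      · by_cases h2 : d ≤ t
        · exact Or.inr (Or.inr h2)
        · have := hpq s t hst
          have hs : s = a - 1 := by lia
          subst hs
          exact Or.inr (Or.inl ⟨le_rfl, Nat.find_min' hex hst⟩)
    · rintro (h1 | ⟨h1, h2⟩ | h1)
      · exact hM _ _ _ _ h1 (Nat.zero_le _) ha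
      · exact hM _ _ _ _ h1 h2 hc
      · exact hM _ _ _ _ (Nat.zero_le _) h1 hd
  · obtain ⟨s₀, t₀, h₀, h₁, h₂⟩ := h.resolve_left hq.ne'
    have h₃ := hpq _ _ h₀
    have hs₀ : ¬ s₀ = 0 := by
      rintro rfl
      have := hd' t₀ h₀
      lia
    refine ⟨1, t₀, by lia, by lia, Or.inr rfl, fun s t => ⟨fun hst => ?_, ?_⟩⟩
    · have h4 := hpq s t hst
      by_cases hs : s = 0
      · subst hs
        exact Or.inr (Or.inr (hd' t hst))
      · lia
    · rintro (h1 | ⟨h1, h2⟩ | h1)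
      · exact hM _ _ _ _ h1 (Nat.zero_le _) ha
      · exact hM _ _ _ _ (by lia) h2 h₀
      · exact hM _ _ _ _ (Nat.zero_le _) h1 hd

/-! ### Variables in the canonical trace -/

theorem le_add_or_le_add_of_mem_support {K : Type u} [Field K]
    {I : Ideal (MvPolynomial (Fin 2) K)} {i j : Fin 2} (hij : i ≠ j)
    {a d : ℕ} {p : MvPolynomial (Fin 2) K} (hp : ∀ m ∈ I, p * m ∈ Ideal.span {X i ^ a, X j ^ d})
    {e : Fin 2 →₀ ℕ} (he : e ∈ p.support) {s t : ℕ} (hst : X i ^ s * X j ^ t ∈ I) :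
    a ≤ e i + s ∨ d ≤ e j + t := by
  have h := hp _ hst
  rw [mem_span_pair_iff hij] at h
  have h2 := h (e + (Finsupp.single i s + Finsupp.single j t)) (by
    rw [X_pow_mul_X_pow_eq_monomial, mem_support_iff, coeff_mul_monomial, mul_one]
    exact mem_support_iff.mp he)
  simpa [hij, hij.symm] using h2

theorem mul_mem_of_forall_le {K : Type u} [Field K]
    {I : Ideal (MvPolynomial (Fin 2) K)} (hI : IsMonomialIdeal I) {i j : Fin 2} (hij : i ≠ j)
    {a d u v : ℕ} (h : ∀ s t, X i ^ s * X j ^ t ∈ I → a ≤ u + s ∨ d ≤ v + t) :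
    ∀ m ∈ I, X i ^ u * X j ^ v * m ∈ Ideal.span {X i ^ a, X j ^ d} := by
  intro m hm
  rw [mem_span_pair_iff hij, X_pow_mul_X_pow_eq_monomial]
  intro e he
  rw [mem_support_iff, coeff_monomial_mul'] at he
  have hle : Finsupp.single i u + Finsupp.single j v ≤ e := by
    by_contra hcon
    exact he (if_neg hcon)
  obtain ⟨e', rfl⟩ := exists_add_of_le hle
  rw [if_pos hle, add_tsub_cancel_left, one_mul] at he
  have h2 := hI.mem_iff.mp hm e' (mem_support_iff.mpr he)
  rw [monomial_eq_X_pow_mul_X_pow hij] at h2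
  simpa [hij, hij.symm] using h _ _ h2

/-- If the variable `x = X i` lies in the trace and `a ≥ 2`, then `I = (x ^ a, x ^ b y ^ c, y ^ d)` with
`a - b = 1` or `b = 1`. Otherwise `x ^ (a - 2)` maps the canonical module `ω_R` into `y ω_R`, so the
image of any `ω_R → R` consists of elements `r` with `x ^ (a - 2) r ∈ y R`; these lie in
`(x ^ 2, y) R`, which does not contain `x`. -/
theorem exists_corner_of_X_mem_trace {K : Type u} [Field K]
    {I : Ideal (MvPolynomial (Fin 2) K)} (hI : IsMonomialIdeal I) (hht : I.height = 2)
    {i j : Fin 2} (hij : i ≠ j) {a d : ℕ} (ha2 : 2 ≤ a)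
    (ha : X i ^ a ∈ I) (ha' : ∀ s, X i ^ s ∈ I → a ≤ s)
    (hd : X j ^ d ∈ I) (hd' : ∀ t, X j ^ t ∈ I → d ≤ t)
    (htr : Ideal.Quotient.mk I (X i) ∈
      moduleTrace (MvPolynomial (Fin 2) K ⧸ I) (CanonicalModule I)) :
    ∃ b c, b < a ∧ c ≤ d ∧ (a - b = 1 ∨ b = 1) ∧
      ∀ s t, X i ^ s * X j ^ t ∈ I ↔ a ≤ s ∨ (b ≤ s ∧ c ≤ t) ∨ d ≤ t := by
  by_contra hcon
  obtain ⟨e⟩ := nonempty_canonicalModule_equiv_of_pow_mem hht hij ha hd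
  set J : Ideal (MvPolynomial (Fin 2) K) := Ideal.span {X i ^ a, X j ^ d} with hJ
  -- multiplication by `x ^ (a - 2)` maps `J : I` into `y (J : I) + J`
  have hmul (p) (hp : ∀ m ∈ I, p * m ∈ J) :
      ∃ p', (∀ m ∈ I, p' * m ∈ J) ∧ X i ^ (a - 2) * p - X j * p' ∈ J := by
    have hmem : X i ^ (a - 2) * p ∈
        Ideal.span {X j} * J.colon (I : Set (MvPolynomial (Fin 2) K)) ⊔ J := by
      rw [p.as_sum, Finset.mul_sum]
      refine Ideal.sum_mem _ fun f hf => ?_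
      have hC (s t : ℕ) (hst : X i ^ s * X j ^ t ∈ I) : a ≤ f i + s ∨ d ≤ f j + t :=
        le_add_or_le_add_of_mem_support hij hp hf hst
      have hf' : X i ^ (a - 2) * monomial f (coeff f p) =
          C (coeff f p) * (X i ^ (a - 2 + f i) * X j ^ f j) := by
        rw [← mul_one (coeff f p), ← C_mul_monomial, monomial_eq_X_pow_mul_X_pow hij, mul_one]
        ring
      rw [hf']
      refine Ideal.mul_mem_left _ _ ?_
      by_cases hJf : X i ^ (a - 2 + f i) * X j ^ f j ∈ J
      · exact Ideal.mem_sup_right hJf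
      refine Ideal.mem_sup_left ?_
      rw [hJ, X_pow_mul_X_pow_mem_span_pair_iff hij, not_or] at hJf
      have hshift : ¬ (f j = 0 ∨ ∃ s t, X i ^ s * X j ^ t ∈ I ∧
          a - 2 + f i + s < a ∧ f j - 1 + t < d) := by
        intro h
        exact hcon (exists_three_corners (M := fun s t => X i ^ s * X j ^ t ∈ I)
          (fun _ _ _ _ => X_pow_mul_X_pow_mem_of_le) (by simpa using ha) ha2 (by simpa using hd)
          (fun t ht => hd' t (by simpa using ht)) hC (by lia) h)
      rw [not_or] at hshift
      obtain ⟨hf0, hshift⟩ := hshift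
      refine Ideal.mem_span_singleton_mul.mpr ⟨X i ^ (a - 2 + f i) * X j ^ (f j - 1), ?_, ?_⟩
      · rw [Submodule.mem_colon]
        refine mul_mem_of_forall_le hI hij fun s t hst => ?_
        by_contra hlt
        exact hshift ⟨s, t, hst, by lia, by lia⟩
      · obtain ⟨k, hk⟩ := Nat.exists_eq_succ_of_ne_zero hf0
        rw [hk, Nat.succ_sub_one, pow_succ]
        ring
    obtain ⟨y, hy, z, hz, hyz⟩ := Submodule.mem_sup.mp hmem
    obtain ⟨p', hp', rfl⟩ := Ideal.mem_span_singleton_mul.mp hy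
    exact ⟨p', Submodule.mem_colon.mp hp', by rw [← hyz, add_sub_cancel_left]; exact hz⟩
  -- as `x ^ (a - 1) ∉ I`, every monomial of `I` outside `(x ^ a)` is divisible by `y`
  have hle : Ideal.span {X j} ⊔ I ≤ Ideal.span {X i ^ a, (X j : MvPolynomial (Fin 2) K) ^ 1} := by
    refine sup_le (Ideal.span_mono (by simp)) (hI.le_of_forall hij fun s t hst => ?_)
    rw [X_pow_mul_X_pow_mem_span_pair_iff hij]
    by_cases ht : t = 0
    · subst ht
      exact Or.inl (ha' s (by simpa using hst))
    · lia
  have htr2 := trace_le_of_forall_mul_sub_mem e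
    (T := Ideal.map (Ideal.Quotient.mk I)
      (Ideal.span {X i ^ 2, (X j : MvPolynomial (Fin 2) K) ^ 1}))
    hmul (fun r hr => Ideal.mem_map_of_mem _ ?_) htr
  · rw [Ideal.mem_quotient_iff_mem_sup] at htr2
    have hle2 : I ≤ Ideal.span {X i ^ 2, (X j : MvPolynomial (Fin 2) K) ^ 1} := by
      refine (le_sup_right.trans hle).trans (Ideal.span_le.mpr ?_)
      rintro _ (rfl | rfl)
      · exact Ideal.mem_of_dvd _ (pow_dvd_pow _ ha2) (Ideal.subset_span (by simp))
      · exact Ideal.subset_span (by simp)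
    rw [sup_eq_left.mpr hle2] at htr2
    have := (X_pow_mul_X_pow_mem_span_pair_iff (K := K) hij 2 1 1 0).mp (by simpa using htr2)
    lia
  · rw [mem_span_pair_iff hij]
    intro f hf
    have h := (mem_span_pair_iff hij _ _ _).mp (hle hr) (Finsupp.single i (a - 2) + f) (by
      rw [X_pow_eq_monomial, mem_support_iff, coeff_monomial_mul, one_mul]
      exact mem_support_iff.mp hf)
    simp [hij] at h
    lia

/-! ### Cohen-Macaulay monomial ideals, heights and numbers of generators -/

theorem mem_span_range_X_iff_constantCoeff_eq_zero {K : Type u} [Field K] {n : ℕ}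
    {p : MvPolynomial (Fin n) K} :
    p ∈ Ideal.span (Set.range X) ↔ constantCoeff p = 0 := by
  rw [← Set.image_univ, mem_ideal_span_X_image]
  constructor
  · intro h
    by_contra h0
    obtain ⟨i, -, hi⟩ := h 0 (mem_support_iff.mpr h0)
    exact hi rfl
  · intro h0 e he
    by_contra! hcon
    have : e = 0 := Finsupp.ext fun i => hcon i (Set.mem_univ i)
    exact mem_support_iff.mp he (by rw [this]; exact h0)

/-- Elements with nonzero constant term are nonzerodivisors modulo a monomial ideal, as far as monomials
are concerned: the coefficient of `s * xᵉ` at `e` is the constant term of `s`. -/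
theorem IsMonomialIdeal.monomial_mem_of_mul_mem {K : Type u} [Field K] {n : ℕ}
    {I : Ideal (MvPolynomial (Fin n) K)} (hI : IsMonomialIdeal I) {s : MvPolynomial (Fin n) K}
    (hs : constantCoeff s ≠ 0) {e : Fin n →₀ ℕ} (h : s * monomial e 1 ∈ I) :
    monomial e (1 : K) ∈ I := by
  refine hI.mem_iff.mp h e ?_
  have := coeff_mul_monomial 0 e (1 : K) s
  rw [zero_add, mul_one] at this
  rw [mem_support_iff, this]
  exact hs

/-- Let `f = x ^ b * y ^ c` be the greatest common divisor of the monomials in `I`. If `f ∉ I` and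
`f ≠ 1`, then powers of `x` and `y` kill the nonzero class of `f` in the localization `A` of `S/I` at
the origin, so `A` has depth zero, while `x` and `y` are not both nilpotent in `A`, so `A` has
positive dimension. -/
theorem IsMonomialIdeal.isPrincipal_or_exists_pow_mem {K : Type u} [Field K]
    {I : Ideal (MvPolynomial (Fin 2) K)} (hI : IsMonomialIdeal I)
    (hCM : IsCohenMacaulay (MvPolynomial (Fin 2) K ⧸ I)) :
    (∃ f, I = Ideal.span {f}) ∨ ∃ a d : ℕ, X 0 ^ a ∈ I ∧ X 1 ^ d ∈ I := by
  classical
  have h01 : (0 : Fin 2) ≠ 1 := by decide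
  by_cases hex : ∃ s t : ℕ, (X 0 ^ s * X 1 ^ t : MvPolynomial (Fin 2) K) ∈ I
  swap
  · refine Or.inl ⟨0, le_antisymm (hI.le_of_forall h01 fun s t h => absurd ⟨s, t, h⟩ hex) ?_⟩
    simp
  have hex' : ∃ t s : ℕ, (X 0 ^ s * X 1 ^ t : MvPolynomial (Fin 2) K) ∈ I :=
    let ⟨s, t, h⟩ := hex; ⟨t, s, h⟩
  obtain ⟨b, ⟨q, hq⟩, hb⟩ : ∃ b, (∃ t, (X 0 ^ b * X 1 ^ t : MvPolynomial (Fin 2) K) ∈ I) ∧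
      ∀ s t, (X 0 ^ s * X 1 ^ t : MvPolynomial (Fin 2) K) ∈ I → b ≤ s :=
    ⟨Nat.find hex, Nat.find_spec hex, fun s t h => Nat.find_min' hex ⟨t, h⟩⟩
  obtain ⟨c, ⟨p, hp⟩, hc⟩ : ∃ c, (∃ s, (X 0 ^ s * X 1 ^ c : MvPolynomial (Fin 2) K) ∈ I) ∧
      ∀ s t, (X 0 ^ s * X 1 ^ t : MvPolynomial (Fin 2) K) ∈ I → c ≤ t :=
    ⟨Nat.find hex', Nat.find_spec hex', fun s t h => Nat.find_min' hex' ⟨s, h⟩⟩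
  by_cases hf : (X 0 ^ b * X 1 ^ c : MvPolynomial (Fin 2) K) ∈ I
  · refine Or.inl ⟨X 0 ^ b * X 1 ^ c, le_antisymm (hI.le_of_forall h01 fun s t h => ?_)
      ((Ideal.span_singleton_le_iff_mem I).mpr hf)⟩
    exact X_pow_mul_X_pow_mem_of_le (hb s t h) (hc s t h) (Ideal.mem_span_singleton_self _)
  by_cases hbc : b = 0 ∧ c = 0
  · obtain ⟨rfl, rfl⟩ := hbc
    exact Or.inr ⟨p, q, by simpa using hp, by simpa using hq⟩
  exfalso
  -- localize at the graded maximal ideal, the kernel of the evaluation at the origin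
  have hI0 (y : MvPolynomial (Fin 2) K) (hy : y ∈ I) : constantCoeff y = 0 := by
    by_contra h0
    have h1 := hI.monomial_mem_of_mul_mem h0 (e := 0) (by simpa using hy)
    exact hbc ⟨Nat.le_zero.mp (hb 0 0 (by simpa using h1)),
      Nat.le_zero.mp (hc 0 0 (by simpa using h1))⟩
  let ε : MvPolynomial (Fin 2) K ⧸ I →+* K := Ideal.Quotient.lift I constantCoeff hI0
  have hε : Function.Surjective ε := fun k => ⟨Ideal.Quotient.mk I (C k), by simp [ε]⟩
  have hmax : (RingHom.ker ε).IsMaximal := RingHom.ker_isMaximal_of_surjective ε hε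
  obtain ⟨rs, hrs, hreg, hlen⟩ := hCM.2 (RingHom.ker ε)
  let A := Localization.AtPrime (RingHom.ker ε)
  let ι : MvPolynomial (Fin 2) K →+* A :=
    (algebraMap (MvPolynomial (Fin 2) K ⧸ I) A).comp (Ideal.Quotient.mk I)
  have hι (s t : ℕ) (h : ι (X 0 ^ s * X 1 ^ t) = 0) : X 0 ^ s * X 1 ^ t ∈ I := by
    obtain ⟨⟨u, hu⟩, huv⟩ :=
      (IsLocalization.map_eq_zero_iff (RingHom.ker ε).primeCompl A _).mp h
    obtain ⟨v, rfl⟩ := Ideal.Quotient.mk_surjective u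
    rw [X_pow_mul_X_pow_eq_monomial]
    refine hI.monomial_mem_of_mul_mem (s := v) (fun h0 => hu ?_) ?_
    · exact (RingHom.mem_ker).mpr h0
    · rw [← X_pow_mul_X_pow_eq_monomial, ← Ideal.Quotient.eq_zero_iff_mem, map_mul]
      exact huv
  have hιI (y) (hy : y ∈ I) : ι y = 0 := by
    change algebraMap _ A (Ideal.Quotient.mk I y) = 0
    rw [Ideal.Quotient.eq_zero_iff_mem.mpr hy, map_zero]
  have hmaxle (N : Ideal A) (h0 : ι (X 0) ∈ N) (h1 : ι (X 1) ∈ N) :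
      IsLocalRing.maximalIdeal A ≤ N := by
    rw [← Localization.AtPrime.map_eq_maximalIdeal, Ideal.map_le_iff_le_comap]
    intro z hz
    obtain ⟨y, rfl⟩ := Ideal.Quotient.mk_surjective z
    have hy : y ∈ Ideal.span (Set.range X) :=
      mem_span_range_X_iff_constantCoeff_eq_zero.mpr (RingHom.mem_ker.mp hz)
    have hle : Ideal.span (Set.range X) ≤ N.comap ι := by
      refine Ideal.span_le.mpr ?_
      rintro _ ⟨i, rfl⟩
      fin_cases i
      · exact h0
      · exact h1
    exact hle hy
  have hX (i : Fin 2) : ι (X i) ∈ IsLocalRing.maximalIdeal A := by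
    rw [← Localization.AtPrime.map_eq_maximalIdeal]
    refine Ideal.mem_map_of_mem _ (RingHom.mem_ker.mpr ?_)
    simp [ε]
  -- the dimension is positive, so the regular sequence is nonempty; its first element has a power
  -- that kills the class of `x ^ b * y ^ c`
  match rs, hrs, hreg, hlen with
  | [], _, _, hlen =>
    have : Ring.KrullDimLE 0 A := by
      rw [Ring.krullDimLE_iff, ← hlen]
      simp
    have hnil (i : Fin 2) : ∃ k, ι (X i ^ k) = 0 := by
      obtain ⟨k, hk⟩ := Ring.KrullDimLE.isNilpotent_iff_mem_maximalIdeal.mpr (hX i)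
      exact ⟨k, by rw [map_pow, hk]⟩
    obtain ⟨k, hk⟩ := hnil 0
    obtain ⟨l, hl⟩ := hnil 1
    exact hbc ⟨Nat.le_zero.mp (hb 0 l (hι 0 l (by simpa using hl))),
      Nat.le_zero.mp (hc k 0 (hι k 0 (by simpa using hk)))⟩
  | r :: rs, hrs, hreg, _ =>
    have hr := ((RingTheory.Sequence.isRegular_cons_iff A r rs).mp hreg).1
    have hrad := hmaxle
      (Ideal.radical (LinearMap.ker (LinearMap.mulRight A (ι (X 0 ^ b * X 1 ^ c)))))
      ⟨p, by
        rw [LinearMap.mem_ker, LinearMap.mulRight_apply, ← map_pow, ← map_mul]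
        refine hιI _ (I.mem_of_dvd (mul_dvd_mul_left _ (dvd_mul_left _ _)) hp)⟩
      ⟨q, by
        rw [LinearMap.mem_ker, LinearMap.mulRight_apply, ← map_pow, ← map_mul]
        refine hιI _ (I.mem_of_dvd ?_ hq)
        rw [mul_comm]
        exact mul_dvd_mul_left _ (dvd_mul_right _ _)⟩ (hrs r (List.mem_cons_self))
    obtain ⟨k, hk⟩ := hrad
    rw [LinearMap.mem_ker, LinearMap.mulRight_apply] at hk
    exact hf (hι b c ((hr.pow k) (by simpa using hk)))

theorem height_eq_two_of_pow_mem {K : Type u} [Field K] {I : Ideal (MvPolynomial (Fin 2) K)}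
    (hle : I ≤ Ideal.span (Set.range X)) {a d : ℕ} (ha : X 0 ^ a ∈ I)
    (hd : X 1 ^ d ∈ I) : I.height = 2 := by
  have hX : Prime (X 0 : MvPolynomial (Fin 2) K) := X_prime
  have hmax : (Ideal.span (Set.range X) : Ideal (MvPolynomial (Fin 2) K)) =
      RingHom.ker (constantCoeff : MvPolynomial (Fin 2) K →+* K) :=
    Ideal.ext fun p => mem_span_range_X_iff_constantCoeff_eq_zero
  have hprime : (Ideal.span (Set.range X) : Ideal (MvPolynomial (Fin 2) K)).IsPrime := by
    rw [hmax]
    exact RingHom.ker_isPrime _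
  apply le_antisymm
  · refine (Ideal.height_mono hle).trans ((Ideal.height_le_spanFinrank _ hprime.ne_top).trans ?_)
    refine Nat.cast_le.mpr ((Submodule.spanFinrank_span_le_ncard_of_finite
      (Set.finite_range _)).trans ?_)
    rw [← Set.image_univ]
    exact (Set.ncard_image_le Set.finite_univ).trans (by simp)
  · rw [Ideal.height_eq_inf_minimalPrimes]
    refine le_iInf₂ fun q hq => ?_
    have hqp : q.IsPrime := hq.isPrime
    have h0 : X 0 ∈ q := hqp.mem_of_pow_mem _ (hq.1.2 ha)
    have h1 : X 1 ∈ q := hqp.mem_of_pow_mem _ (hq.1.2 hd)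
    have hp : (Ideal.span {(X 0 : MvPolynomial (Fin 2) K)}).IsPrime :=
      (Ideal.span_singleton_prime hX.ne_zero).mpr hX
    have hlt1 : (⊥ : Ideal (MvPolynomial (Fin 2) K)) < Ideal.span {X 0} := by
      rw [bot_lt_iff_ne_bot, Ne, Ideal.span_singleton_eq_bot]
      exact hX.ne_zero
    have hlt2 : Ideal.span {X 0} < q := by
      refine lt_of_le_of_ne ((Ideal.span_singleton_le_iff_mem q).mpr h0) fun h => ?_
      rw [← h, Ideal.mem_span_singleton, X_dvd_X] at h1
      exact absurd h1 (by decide)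
    have hb := Ideal.height_add_one_le_of_lt_of_isPrime hlt1
    have hc := Ideal.height_add_one_le_of_lt_of_isPrime hlt2
    rw [Ideal.height_bot, zero_add] at hb
    exact (add_le_add_left hb 1).trans hc

/-- The exponents of minimal monomial generators give linearly independent functionals on
`I / (x₁, …, xₙ) I`. -/
theorem card_le_spanFinrank_of_minimal {K : Type u} [Field K] {n : ℕ}
    {I : Ideal (MvPolynomial (Fin n) K)} (hI : IsMonomialIdeal I) (F : Finset (Fin n →₀ ℕ))
    (hF : ∀ e ∈ F, monomial e (1 : K) ∈ I)
    (hmin : ∀ e ∈ F, ∀ e' ≤ e, monomial e' (1 : K) ∈ I → e' = e) :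
    F.card ≤ Submodule.spanFinrank I := by
  classical
  obtain ⟨G, hG, hGI⟩ := Submodule.FG.exists_span_finset_card_eq_spanFinrank
    (IsNoetherian.noetherian I)
  let Φ : MvPolynomial (Fin n) K →ₗ[K] (F → K) := LinearMap.pi fun e => lcoeff K e.1
  have hΦ (g p : MvPolynomial (Fin n) K) (hp : p ∈ I) : Φ (g * p) = constantCoeff g • Φ p := by
    funext e
    change coeff e.1 (g * p) = coeff 0 g * coeff e.1 p
    rw [coeff_mul, Finset.sum_eq_single (0, e.1)]
    · rintro ⟨u, v⟩ huv hne
      rw [Finset.HasAntidiagonal.mem_antidiagonal] at huv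
      by_cases hv : coeff v p = 0
      · simp [hv]
      · have := hmin e.1 e.2 v (huv ▸ le_add_self) (hI.mem_iff.mp hp v (mem_support_iff.mpr hv))
        subst this
        exact (hne (congrArg (·, e.1) (add_eq_right.mp huv))).elim
    · intro h
      simp at h
  have hspan (p) (hp : p ∈ I) : Φ p ∈ Submodule.span K ((G.image Φ : Finset _) : Set (F → K)) := by
    have hp' := hp
    rw [← hGI] at hp'
    induction hp' using Submodule.span_induction with
    | mem x hx => exact Submodule.subset_span (by simpa using ⟨x, hx, rfl⟩)
    | zero => simp
    | add x y hx hy ihx ihy =>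
      rw [hGI] at hx hy
      rw [map_add]
      exact add_mem (ihx hx) (ihy hy)
    | smul g x hx ih =>
      rw [hGI] at hx
      rw [smul_eq_mul, hΦ g x hx]
      exact Submodule.smul_mem _ _ (ih hx)
  have htop : Submodule.span K ((G.image Φ : Finset _) : Set (F → K)) = ⊤ := by
    rw [eq_top_iff, ← (Pi.basisFun K F).span_eq, Submodule.span_le]
    rintro _ ⟨e, rfl⟩
    have h : Pi.basisFun K F e = Φ (monomial e.1 1) := by
      funext e'
      rw [Pi.basisFun_apply, Pi.single_apply]
      change _ = coeff e'.1 (monomial e.1 (1 : K))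
      rw [coeff_monomial]
      by_cases he : e' = e
      · rw [if_pos he, if_pos (congrArg _ he.symm)]
      · rw [if_neg he, if_neg fun h => he (Subtype.ext h.symm)]
    rw [h]
    exact hspan _ (hF e.1 e.2)
  have hcard : Module.finrank K (Submodule.span K ((G.image Φ : Finset _) : Set (F → K))) ≤ _ :=
    finrank_span_finset_le_card (R := K) (G.image Φ)
  rw [htop, finrank_top, Module.finrank_fintype_fun_eq_card, Fintype.card_coe] at hcard
  exact (hcard.trans Finset.card_image_le).trans_eq hG

theorem IsMonomialIdeal.eq_span_pair_of_spanFinrank_le_two {K : Type u} [Field K]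
    {I : Ideal (MvPolynomial (Fin 2) K)} (hI : IsMonomialIdeal I) {a d : ℕ} (ha1 : 1 ≤ a)
    (ha : X 0 ^ a ∈ I) (ha' : ∀ s, X 0 ^ s ∈ I → a ≤ s)
    (hd : X 1 ^ d ∈ I) (hd' : ∀ t, X 1 ^ t ∈ I → d ≤ t) (h2 : Submodule.spanFinrank I ≤ 2) :
    I = Ideal.span {X 0 ^ a, X 1 ^ d} := by
  classical
  have h01 : (0 : Fin 2) ≠ 1 := by decide
  refine hI.eq_span_pair h01 fun s t => ⟨fun hst => ?_, ?_⟩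
  swap
  · rintro (h | h)
    · exact I.mul_mem_right _ (I.mem_of_dvd (pow_dvd_pow _ h) ha)
    · exact I.mul_mem_left _ (I.mem_of_dvd (pow_dvd_pow _ h) hd)
  by_contra hcon
  -- a third minimal generator, of least degree among the monomials of `I` inside the box
  have hex : ∃ k s t, s < a ∧ t < d ∧ s + t = k ∧
      (X 0 ^ s * X 1 ^ t : MvPolynomial (Fin 2) K) ∈ I := ⟨s + t, s, t, by lia, by lia, rfl, hst⟩
  obtain ⟨s₀, t₀, hs₀, ht₀, hk, h₀⟩ := Nat.find_spec hex
  have hmin₀ (s t : ℕ) (hs : s < a) (ht : t < d)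
      (h : (X 0 ^ s * X 1 ^ t : MvPolynomial (Fin 2) K) ∈ I) : s₀ + t₀ ≤ s + t := by
    rw [hk]
    exact Nat.find_min' hex ⟨s, t, hs, ht, rfl, h⟩
  let m (s t : ℕ) : Fin 2 →₀ ℕ := Finsupp.single 0 s + Finsupp.single 1 t
  have hm0 (s t : ℕ) : m s t 0 = s := by simp [m]
  have hm1 (s t : ℕ) : m s t 1 = t := by simp [m]
  have hm {s t s' t' : ℕ} (h : m s t = m s' t') : s = s' ∧ t = t' :=
    ⟨by rw [← hm0 s t, h, hm0], by rw [← hm1 s t, h, hm1]⟩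
  have hcard : ({m a 0, m 0 d, m s₀ t₀} : Finset (Fin 2 →₀ ℕ)).card = 3 := by
    rw [Finset.card_eq_three]
    refine ⟨_, _, _, fun h => ?_, fun h => ?_, fun h => ?_, rfl⟩ <;>
    · have := hm h
      lia
  have h3 := card_le_spanFinrank_of_minimal hI {m a 0, m 0 d, m s₀ t₀} (by
    simp only [Finset.mem_insert, Finset.mem_singleton, m]
    rintro _ (rfl | rfl | rfl) <;> rw [← X_pow_mul_X_pow_eq_monomial]
    · simpa using ha
    · simpa using hd
    · exact h₀) (by
    intro e he e' hle hmem
    rw [monomial_eq_X_pow_mul_X_pow h01] at hmem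
    have hle0 := hle 0
    have hle1 := hle 1
    refine Finsupp.ext ((Fin.forall_fin_two).mpr ?_)
    simp only [Finset.mem_insert, Finset.mem_singleton] at he
    rcases he with rfl | rfl | rfl <;> rw [hm0] at hle0 ⊢ <;> rw [hm1] at hle1 ⊢
    · have h1 : e' 1 = 0 := by lia
      have := ha' (e' 0) (by simpa [h1] using hmem)
      lia
    · have h1 : e' 0 = 0 := by lia
      have := hd' (e' 1) (by simpa [h1] using hmem)
      lia
    · have := hmin₀ _ _ (by lia) (by lia) hmem
      lia)
  lia

/-! ### Nearly Gorenstein monomial ideals -/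

theorem isNearlyGorenstein_of_one_mem_trace {K : Type u} [Field K] {n : ℕ}
    {I : Ideal (MvPolynomial (Fin n) K)}
    (h : Ideal.Quotient.mk I 1 ∈ moduleTrace (MvPolynomial (Fin n) K ⧸ I) (CanonicalModule I)) :
    IsNearlyGorenstein I := by
  rw [map_one] at h
  rw [IsNearlyGorenstein, (Ideal.eq_top_iff_one _).mpr h]
  exact le_top

theorem isNearlyGorenstein_iff {K : Type u} [Field K] {I : Ideal (MvPolynomial (Fin 2) K)} :
    IsNearlyGorenstein I ↔
      Ideal.Quotient.mk I (X 0) ∈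
        moduleTrace (MvPolynomial (Fin 2) K ⧸ I) (CanonicalModule I) ∧
      Ideal.Quotient.mk I (X 1) ∈
        moduleTrace (MvPolynomial (Fin 2) K ⧸ I) (CanonicalModule I) := by
  rw [IsNearlyGorenstein, Ideal.map_le_iff_le_comap, Ideal.span_le, Set.range_subset_iff,
    Fin.forall_fin_two]
  rfl

theorem isNearlyGorenstein_span_singleton {K : Type u} [Field K] {n : ℕ}
    (f : MvPolynomial (Fin n) K) : IsNearlyGorenstein (Ideal.span {f}) := by
  by_cases hf : IsUnit f
  · have : Subsingleton (MvPolynomial (Fin n) K ⧸ Ideal.span {f}) :=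
      Ideal.Quotient.subsingleton_iff.mpr (Ideal.span_singleton_eq_top.mpr hf)
    refine isNearlyGorenstein_of_one_mem_trace ?_
    rw [Subsingleton.elim (Ideal.Quotient.mk (Ideal.span {f}) 1) 0]
    exact zero_mem _
  · obtain ⟨e⟩ := nonempty_canonicalModule_span_singleton_equiv hf
    exact isNearlyGorenstein_of_one_mem_trace
      (mk_mem_trace_of_forall_mul_mem le_rfl e fun m hm => by rwa [one_mul])

theorem X_pow_mul_X_pow_dvd_of_dvd_add_mul {K : Type u} [Field K] {a d : ℕ} (ha : 1 ≤ a)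
    (hd : 1 ≤ d) (b c : ℕ) {h : MvPolynomial (Fin 2) K}
    (hh : X 0 ^ b * X 1 ^ c ∣ (X 0 ^ a + X 1 ^ d) * h) : X 0 ^ b * X 1 ^ c ∣ h := by
  have h01 : (0 : Fin 2) ≠ 1 := by decide
  have h0 : ¬ (X 0 : MvPolynomial (Fin 2) K) ∣ X 0 ^ a + X 1 ^ d := fun h =>
    not_X_dvd_X_pow h01 d ((dvd_add_right (dvd_pow_self _ (by lia))).mp h)
  have h1 : ¬ (X 1 : MvPolynomial (Fin 2) K) ∣ X 0 ^ a + X 1 ^ d := fun h =>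
    not_X_dvd_X_pow h01.symm a ((dvd_add_left (dvd_pow_self _ (by lia))).mp h)
  obtain ⟨h', rfl⟩ := (X_prime (R := K) (i := (0 : Fin 2))).pow_dvd_of_dvd_mul_left b h0
    ((dvd_mul_right _ _).trans hh)
  refine mul_dvd_mul_left _ ((X_prime (R := K) (i := (1 : Fin 2))).pow_dvd_of_dvd_mul_left c
    (a := (X 0 ^ a + X 1 ^ d) * X 0 ^ b) (fun hd => ?_) ?_)
  · rcases (X_prime (R := K) (i := (1 : Fin 2))).dvd_or_dvd hd with h | h
    · exact h1 h
    · exact not_X_dvd_X_pow h01.symm b h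
  · rw [mul_assoc]
    exact (dvd_mul_left _ _).trans hh

theorem forall_mul_mem_of_span_triple {A : Type*} [CommRing A] {f g h p : A} {J : Ideal A}
    (hf : p * f ∈ J) (hg : p * g ∈ J) (hh : p * h ∈ J) :
    ∀ m ∈ Ideal.span {f, g, h}, p * m ∈ J := by
  have : Ideal.span {f, g, h} ≤ Submodule.comap (LinearMap.lsmul A A p) J := by
    refine Ideal.span_le.mpr ?_
    rintro _ (rfl | rfl | rfl)
    exacts [hf, hg, hh]
  exact this

/-- The variables are found in the colon ideals `J : I` of two complete intersections `J ⊆ I`: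
`(x ^ a, y ^ d) : I` contains `x ^ (a - b)` and `y ^ (d - c)`, and
`(x ^ b * y ^ c, x ^ a + y ^ d) : I` contains `x ^ b` and `y ^ c`. -/
theorem isNearlyGorenstein_span_triple {K : Type u} [Field K] {a b c d : ℕ} (hb : 1 ≤ b)
    (hba : b < a) (hc : 1 ≤ c) (hcd : c < d) (hab : a - b = 1 ∨ b = 1) (hdc : d - c = 1 ∨ c = 1)
    (hht : (Ideal.span {X 0 ^ a, X 0 ^ b * X 1 ^ c, X 1 ^ d} :
      Ideal (MvPolynomial (Fin 2) K)).height = 2) :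
    IsNearlyGorenstein (Ideal.span {X 0 ^ a, X 0 ^ b * X 1 ^ c, X 1 ^ d} :
      Ideal (MvPolynomial (Fin 2) K)) := by
  have h01 : (0 : Fin 2) ≠ 1 := by decide
  set x : MvPolynomial (Fin 2) K := X 0 with hx
  set y : MvPolynomial (Fin 2) K := X 1 with hy
  set I : Ideal (MvPolynomial (Fin 2) K) := Ideal.span {x ^ a, x ^ b * y ^ c, y ^ d} with hI
  have haI : x ^ a ∈ I := Ideal.subset_span (by simp)
  have hbI : x ^ b * y ^ c ∈ I := Ideal.subset_span (by simp)
  have hdI : y ^ d ∈ I := Ideal.subset_span (by simp)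
  obtain ⟨k, rfl⟩ := Nat.exists_eq_add_of_le hba.le
  obtain ⟨l, rfl⟩ := Nat.exists_eq_add_of_le hcd.le
  obtain ⟨e₁⟩ := nonempty_canonicalModule_equiv_of_pow_mem hht h01 haI hdI
  have hle₁ : Ideal.span {x ^ (b + k), y ^ (c + l)} ≤ I := by
    refine Ideal.span_le.mpr ?_
    rintro _ (rfl | rfl)
    exacts [haI, hdI]
  have ha₁ : x ^ (b + k) ∈ Ideal.span {x ^ (b + k), y ^ (c + l)} := Ideal.subset_span (by simp)
  have hd₁ : y ^ (c + l) ∈ Ideal.span {x ^ (b + k), y ^ (c + l)} := Ideal.subset_span (by simp)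
  obtain ⟨e₂⟩ := nonempty_canonicalModule_equiv_of_height_eq_two hht
    (f := x ^ b * y ^ c) (g := x ^ (b + k) + y ^ (c + l))
    (mul_ne_zero (pow_ne_zero _ (X_ne_zero (R := K) _)) (pow_ne_zero _ (X_ne_zero (R := K) _)))
    hbI (add_mem haI hdI)
    (fun h => X_pow_mul_X_pow_dvd_of_dvd_add_mul (by lia) (by lia) b c)
  have hle₂ : Ideal.span {x ^ b * y ^ c, x ^ (b + k) + y ^ (c + l)} ≤ I := by
    refine Ideal.span_le.mpr ?_
    rintro _ (rfl | rfl)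
    exacts [hbI, add_mem haI hdI]
  have hk : Ideal.Quotient.mk I (x ^ k) ∈
      moduleTrace (MvPolynomial (Fin 2) K ⧸ I) (CanonicalModule I) := by
    refine mk_mem_trace_of_forall_mul_mem hle₁ e₁ (forall_mul_mem_of_span_triple
      (Ideal.mul_mem_left _ _ ha₁) ?_ (Ideal.mul_mem_left _ _ hd₁))
    rw [show x ^ k * (x ^ b * y ^ c) = y ^ c * x ^ (b + k) by ring]
    exact Ideal.mul_mem_left _ _ ha₁
  have hl : Ideal.Quotient.mk I (y ^ l) ∈
      moduleTrace (MvPolynomial (Fin 2) K ⧸ I) (CanonicalModule I) := by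
    refine mk_mem_trace_of_forall_mul_mem hle₁ e₁ (forall_mul_mem_of_span_triple
      (Ideal.mul_mem_left _ _ ha₁) ?_ (Ideal.mul_mem_left _ _ hd₁))
    rw [show y ^ l * (x ^ b * y ^ c) = x ^ b * y ^ (c + l) by ring]
    exact Ideal.mul_mem_left _ _ hd₁
  have hb : Ideal.Quotient.mk I (x ^ b) ∈
      moduleTrace (MvPolynomial (Fin 2) K ⧸ I) (CanonicalModule I) := by
    refine mk_mem_trace_of_forall_mul_mem hle₂ e₂ (forall_mul_mem_of_span_triple ?_ ?_ ?_)
    · exact Ideal.mem_span_pair.mpr ⟨-y ^ l, x ^ b, by ring⟩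
    · exact Ideal.mem_span_pair.mpr ⟨x ^ b, 0, by ring⟩
    · exact Ideal.mem_span_pair.mpr ⟨y ^ l, 0, by ring⟩
  have hc : Ideal.Quotient.mk I (y ^ c) ∈
      moduleTrace (MvPolynomial (Fin 2) K ⧸ I) (CanonicalModule I) := by
    refine mk_mem_trace_of_forall_mul_mem hle₂ e₂ (forall_mul_mem_of_span_triple ?_ ?_ ?_)
    · exact Ideal.mem_span_pair.mpr ⟨x ^ k, 0, by ring⟩
    · exact Ideal.mem_span_pair.mpr ⟨y ^ c, 0, by ring⟩
    · exact Ideal.mem_span_pair.mpr ⟨-x ^ k, y ^ c, by ring⟩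
  refine isNearlyGorenstein_iff.mpr ⟨?_, ?_⟩
  · rcases hab with h | h
    · rw [Nat.add_sub_cancel_left] at h
      rwa [h, pow_one] at hk
    · rwa [h, pow_one] at hb
  · rcases hdc with h | h
    · rw [Nat.add_sub_cancel_left] at h
      rwa [h, pow_one] at hl
    · rwa [h, pow_one] at hc

theorem exists_minimal_pow_mem {A : Type*} [CommRing A] {I : Ideal A} {x : A} {a : ℕ}
    (ha : x ^ a ∈ I) (hI : I ≠ ⊤) :
    ∃ a, 1 ≤ a ∧ x ^ a ∈ I ∧ ∀ s, x ^ s ∈ I → a ≤ s := by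
  classical
  have hex : ∃ a, x ^ a ∈ I := ⟨a, ha⟩
  refine ⟨Nat.find hex, ?_, Nat.find_spec hex, fun s hs => Nat.find_min' hex hs⟩
  rw [Nat.one_le_iff_ne_zero]
  intro h
  have := Nat.find_spec hex
  rw [h, pow_zero] at this
  exact hI ((Ideal.eq_top_iff_one I).mpr this)

theorem spanFinrank_span_pair_le {A : Type*} [CommRing A] (f g : A) :
    Submodule.spanFinrank (Ideal.span {f, g}) ≤ 2 := by
  refine (Submodule.spanFinrank_span_le_ncard_of_finite (by simp)).trans ?_
  exact (Set.ncard_insert_le _ _).trans (by simp)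

theorem spanFinrank_span_triple_le {A : Type*} [CommRing A] (f g h : A) :
    Submodule.spanFinrank (Ideal.span {f, g, h}) ≤ 3 := by
  refine (Submodule.spanFinrank_span_le_ncard_of_finite (by simp)).trans
    ((Set.ncard_insert_le _ _).trans ?_)
  exact Nat.succ_le_succ ((Set.ncard_insert_le _ _).trans (by simp))

theorem spanFinrank_span_singleton_le {A : Type*} [CommRing A] (f : A) :
    Submodule.spanFinrank (Ideal.span {f}) ≤ 1 :=
  (Submodule.spanFinrank_span_le_ncard_of_finite (by simp)).trans (by simp)

theorem IsMonomialIdeal.le_span_range_X {K : Type u} [Field K] {n : ℕ}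
    {I : Ideal (MvPolynomial (Fin n) K)} (hI : IsMonomialIdeal I) (hne : I ≠ ⊤) :
    I ≤ Ideal.span (Set.range X) := by
  intro p hp
  rw [mem_span_range_X_iff_constantCoeff_eq_zero]
  by_contra h0
  refine hne ((Ideal.eq_top_iff_one I).mpr ?_)
  simpa using hI.monomial_mem_of_mul_mem h0 (e := 0) (by simpa using hp)

/-- Each variable in the trace gives a presentation of `I` with one inner corner; since `I` needs more
than two generators, the two corners are genuine and therefore equal. -/
theorem exists_span_triple_of_X_mem_trace {K : Type u} [Field K]
    {I : Ideal (MvPolynomial (Fin 2) K)} (hI : IsMonomialIdeal I) (hht : I.height = 2)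
    (h3 : ¬ Submodule.spanFinrank I ≤ 2) {a d : ℕ} (ha1 : 1 ≤ a) (hd1 : 1 ≤ d)
    (ha : X 0 ^ a ∈ I) (ha' : ∀ s, X 0 ^ s ∈ I → a ≤ s)
    (hd : X 1 ^ d ∈ I) (hd' : ∀ t, X 1 ^ t ∈ I → d ≤ t)
    (h0 : Ideal.Quotient.mk I (X 0) ∈
      moduleTrace (MvPolynomial (Fin 2) K ⧸ I) (CanonicalModule I))
    (h1 : Ideal.Quotient.mk I (X 1) ∈
      moduleTrace (MvPolynomial (Fin 2) K ⧸ I) (CanonicalModule I)) :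
    ∃ b c, 1 ≤ b ∧ b < a ∧ c < d ∧ (a - b = 1 ∨ b = 1) ∧ (d - c = 1 ∨ c = 1) ∧
      I = Ideal.span {X 0 ^ a, X 0 ^ b * X 1 ^ c, X 1 ^ d} := by
  have h01 : (0 : Fin 2) ≠ 1 := by decide
  -- two generators do not suffice, so `I` has a monomial divisible by neither pure power
  have hbox : ∃ s t, s < a ∧ t < d ∧ (X 0 ^ s * X 1 ^ t : MvPolynomial (Fin 2) K) ∈ I := by
    by_contra! hcon
    refine h3 ?_
    rw [hI.eq_span_pair h01 (a := a) (d := d) fun s t => ⟨fun hst => ?_, ?_⟩]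
    · exact spanFinrank_span_pair_le _ _
    · by_contra hlt
      exact hcon s t (by lia) (by lia) hst
    · rintro (h | h)
      · exact I.mul_mem_right _ (I.mem_of_dvd (pow_dvd_pow _ h) ha)
      · exact I.mul_mem_left _ (I.mem_of_dvd (pow_dvd_pow _ h) hd)
  obtain ⟨s, t, hs, ht, hst⟩ := hbox
  have hs1 : s ≠ 0 := by
    rintro rfl
    have := hd' t (by simpa using hst)
    lia
  have ht1 : t ≠ 0 := by
    rintro rfl
    have := ha' s (by simpa using hst)
    lia
  obtain ⟨b, c, hb, -, hab, hbc⟩ :=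
    exists_corner_of_X_mem_trace hI hht h01 (by lia) ha ha' hd hd' h0
  obtain ⟨c', b', hc', -, hdc, hcb⟩ :=
    exists_corner_of_X_mem_trace hI hht h01.symm (by lia) hd hd' ha ha' h1
  have hcorner := (hbc s t).mp hst
  have hcorner' := (hcb t s).mp (by rwa [mul_comm])
  have hmem := (hbc b c).mpr (Or.inr (Or.inl ⟨le_rfl, le_rfl⟩))
  have hmem' := (hcb c' b').mpr (Or.inr (Or.inl ⟨le_rfl, le_rfl⟩))
  have e1 := (hcb c b).mp (by rwa [mul_comm])
  have e2 := (hbc b' c').mp (by rwa [mul_comm])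
  have hcc : c = c' := by lia
  subst hcc
  refine ⟨b, c, by lia, hb, by lia, hab, hdc, hI.eq_span_triple h01 hbc⟩

theorem proposition3p5 {K : Type u} [Field K] (I : Ideal (MvPolynomial (Fin 2) K))
    (hI : IsMonomialIdeal I) (hCM : IsCohenMacaulay (MvPolynomial (Fin 2) K ⧸ I)) :
    IsNearlyGorenstein I ↔
      Submodule.spanFinrank I ≤ 2 ∨
      (Submodule.spanFinrank I = 3 ∧ ∃ a b c d : ℕ, b < a ∧ c < d ∧
        I = Ideal.span {X 0 ^ a, X 0 ^ b * X 1 ^ c, X 1 ^ d} ∧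
        (a - b = 1 ∨ b = 1) ∧ (d - c = 1 ∨ c = 1) ∧ 1 ≤ b + c) := by
  rcases hI.isPrincipal_or_exists_pow_mem hCM with ⟨f, rfl⟩ | ⟨a, d, ha, hd⟩
  · exact iff_of_true (isNearlyGorenstein_span_singleton f)
      (Or.inl ((spanFinrank_span_singleton_le f).trans one_le_two))
  by_cases htop : I = ⊤
  · have hI1 : I = Ideal.span {1} := by rw [htop, Ideal.span_singleton_one]
    subst hI1
    exact iff_of_true (isNearlyGorenstein_span_singleton 1)
      (Or.inl ((spanFinrank_span_singleton_le _).trans one_le_two))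
  have hht := height_eq_two_of_pow_mem (hI.le_span_range_X htop) ha hd
  obtain ⟨a, ha1, ha, ha'⟩ := exists_minimal_pow_mem ha htop
  obtain ⟨d, hd1, hd, hd'⟩ := exists_minimal_pow_mem hd htop
  constructor
  · intro hNG
    obtain ⟨h0, h1⟩ := isNearlyGorenstein_iff.mp hNG
    by_cases h2 : Submodule.spanFinrank I ≤ 2
    · exact Or.inl h2
    obtain ⟨b, c, hb, hba, hcd, hab, hdc, hIeq⟩ :=
      exists_span_triple_of_X_mem_trace hI hht h2 ha1 hd1 ha ha' hd hd' h0 h1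
    refine Or.inr ⟨le_antisymm ?_ (by lia), a, b, c, d, hba, hcd, hIeq, hab, hdc, by lia⟩
    rw [hIeq]
    exact spanFinrank_span_triple_le _ _ _
  · rintro (h2 | ⟨h3, a', b, c, d', hba, hcd, hIeq, hab, hdc, -⟩)
    · have hIeq := hI.eq_span_pair_of_spanFinrank_le_two ha1 ha ha' hd hd' h2
      obtain ⟨e⟩ := nonempty_canonicalModule_equiv_of_pow_mem hht (by decide) ha hd
      exact isNearlyGorenstein_of_one_mem_trace
        (mk_mem_trace_of_forall_mul_mem hIeq.ge e fun m hm => by rwa [one_mul, ← hIeq])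
    -- if `b = 0` or `c = 0`, one of the three generators is redundant
    · have hb : b ≠ 0 := by
        rintro rfl
        have : I = Ideal.span {X 0 ^ a', X 1 ^ c} := by
          refine hI.eq_span_pair (by decide) fun s t => ?_
          rw [hIeq, X_pow_mul_X_pow_mem_span_triple_iff (by decide)]
          lia
        have := spanFinrank_span_pair_le (X 0 ^ a' : MvPolynomial (Fin 2) K) (X 1 ^ c)
        simp_all
      have hc : c ≠ 0 := by
        rintro rfl
        have : I = Ideal.span {X 0 ^ b, X 1 ^ d'} := by
          refine hI.eq_span_pair (by decide) fun s t => ?_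
          rw [hIeq, X_pow_mul_X_pow_mem_span_triple_iff (by decide)]
          lia
        have := spanFinrank_span_pair_le (X 0 ^ b : MvPolynomial (Fin 2) K) (X 1 ^ d')
        simp_all
      subst hIeq
      exact isNearlyGorenstein_span_triple (by lia) hba (by lia) hcd hab hdc hht
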